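/- All graphs are finite, undirected, simple and loopless. For a graph $G=(V,E)$ and $S\subseteq V$ let $N(S)=\bigl(\bigcup_{x\in S}N(x)\bigr)\setminus S$. For a real number $c>0$, $G$ is a *$c$-expander* if $|N(S)|\ge c\,|S|$ for every $S\subseteq V$ with $|S|\le |V|/2$. A *chordal completion* of $G$ is a chordal graph $H=(V,E')$ with $E\subseteq E'$ (chordal: every cycle of length at least $4$ has a chord). For every real number $c>0$ there is a real number $K>0$, depending only on $c$, such that for every $n\ge 2$ and every $c$-expander $G$ on $n$ vertices: 1. the treewidth of $G$ is at least $K\,n$; 2. every chordal completion $H$ of $G$ contains a clique with at least $K\,n$ vertices; 3. every chordal completion $H$ of $G$ has at least $K\,n^2$ edges. -/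

import Mathlib

universe u

namespace ChordalLB

/-- The outer neighbourhood `N(S) = (⋃ x ∈ S, N(x)) \ S` of a vertex set `S`. -/
def outerNbhd {V : Type u} (G : SimpleGraph V) (S : Set V) : Set V :=
  (⋃ x ∈ S, G.neighborSet x) \ S

/-- `G` is a (vertex) `c`-expander: `|N(S)| ≥ c |S|` for every `S` with `|S| ≤ |V| / 2`. -/
def IsExpander {V : Type u} [Fintype V] (G : SimpleGraph V) (c : ℝ) : Prop :=
  ∀ S : Finset V, (S.card : ℝ) ≤ (Fintype.card V : ℝ) / 2 →
    c * (S.card : ℝ) ≤ ((outerNbhd G (S : Set V)).ncard : ℝ)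

/-- A graph is chordal if every cycle of length at least `4` has a chord, that is, an edge of the
graph that joins two vertices of the cycle and is not an edge of the cycle. -/
def IsChordal {V : Type u} (G : SimpleGraph V) : Prop :=
  ∀ (v : V) (p : G.Walk v v), p.IsCycle → 4 ≤ p.length →
    ∃ x ∈ p.support, ∃ y ∈ p.support, G.Adj x y ∧ s(x, y) ∉ p.edges

/-- `H` is a chordal completion of `G`: a chordal graph on the same vertices, obtained from `G` by
adding (possibly no) edges. -/
def IsChordalCompletion {V : Type u} (G H : SimpleGraph V) : Prop :=
  G ≤ H ∧ IsChordal H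

/-- The graph `T` together with the bags `bag t` is a tree decomposition of `G`. -/
structure IsTreeDecomposition {V : Type u} (G : SimpleGraph V) {ι : Type}
    (T : SimpleGraph ι) (bag : ι → Finset V) : Prop where
  isTree : T.IsTree
  vertex_mem : ∀ v : V, ∃ t, v ∈ bag t
  edge_mem : ∀ v w : V, G.Adj v w → ∃ t, v ∈ bag t ∧ w ∈ bag t
  connected : ∀ v : V, (T.induce {t | v ∈ bag t}).Preconnected

/-- `G` has a tree decomposition (over a finite tree) of width at most `w`, that is, with all bags
of size at most `w + 1`. -/
def HasTreeDecompositionOfWidth {V : Type u} (G : SimpleGraph V) (w : ℕ) : Prop :=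
  ∃ (m : ℕ) (T : SimpleGraph (Fin m)) (bag : Fin m → Finset V),
    IsTreeDecomposition G T bag ∧ ∀ t, (bag t).card ≤ w + 1

/-- The treewidth of a finite graph: the least width of a tree decomposition (with the value `0`
for the graph without vertices). -/
noncomputable def treewidth {V : Type u} (G : SimpleGraph V) : ℕ :=
  sInf {w : ℕ | HasTreeDecompositionOfWidth G w}

/-- A finite graph has some tree decomposition, so the infimum defining `treewidth` is attained. -/
theorem exists_hasTreeDecompositionOfWidth {V : Type u} [Fintype V] (G : SimpleGraph V) :
    ∃ w : ℕ, HasTreeDecompositionOfWidth G w := by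
  refine ⟨Fintype.card V, 1, ⊥, fun _ => Finset.univ, ⟨?_, ?_, ?_, ?_⟩, ?_⟩
  · exact SimpleGraph.IsTree.of_subsingleton
  · exact fun v => ⟨0, Finset.mem_univ v⟩
  · exact fun v w _ => ⟨0, Finset.mem_univ v, Finset.mem_univ w⟩
  · exact fun v => SimpleGraph.Preconnected.of_subsingleton
  · intro t
    simp

end ChordalLB

namespace ChordalLB

open SimpleGraph

/-! Let `P` be a family of vertex sets closed under subsets: the subsets of bags, or the cliques of
a chordal completion (itself an expander). Choose a smallest connected `C` that has more than half
of the `n` vertices and `N(C)` in `P`. In both cases some `v` in `C` can be added to `N(C)`, giving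
`X` in `P`. Every component of `C \ {v}` has its neighbourhood in `X`, so by minimality it has at
most `n/2` vertices. Hence some union of components has between `n/4` and `n/2` vertices, and
expansion forces `|X| ≥ cn/4` (`IsExpander.exists_large`).

For bags, `v` comes from the Helly-type property of subtrees (`exists_gate`); for cliques, it is a
vertex of `C` with the most neighbours in `N(C)` (`IsChordal.exists_isClique_insert`). A linear
clique has quadratically many edges. -/

/-- A vertex set in which any two vertices are joined by a walk that stays in the set. -/
def WalkConnected {V : Type*} (G : SimpleGraph V) (C : Set V) : Prop :=
  ∀ a ∈ C, ∀ b ∈ C, ∃ p : G.Walk a b, ∀ z ∈ p.support, z ∈ C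

/-! ### Walks inside a vertex set -/

section Walks

variable {V : Type*} {G : SimpleGraph V}

lemma walkConnected_of_induce_preconnected {C : Set V} (h : (G.induce C).Preconnected) :
    WalkConnected G C := by
  intro a ha b hb
  obtain ⟨p⟩ := h ⟨a, ha⟩ ⟨b, hb⟩
  refine ⟨p.map (Embedding.induce C).toHom, fun z hz => ?_⟩
  obtain ⟨y, -, rfl⟩ := List.mem_map.1 ((Walk.support_map _ p) ▸ hz)
  exact y.2

/-- The vertices that can be reached from a fixed vertex inside a given set are connected. -/
lemma walkConnected_reachable_within (B : Set V) (u : V) :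
    WalkConnected G {x | ∃ p : G.Walk u x, ∀ z ∈ p.support, z ∈ B} := by
  classical
  have key : ∀ (x : V) (p : G.Walk u x), (∀ z ∈ p.support, z ∈ B) →
      ∀ z ∈ p.support, ∃ q : G.Walk u z, ∀ y ∈ q.support, y ∈ B := fun x p hp z hz =>
    ⟨p.takeUntil z hz, fun y hy => hp y (p.support_takeUntil_subset_support hz hy)⟩
  rintro a ⟨p, hp⟩ b ⟨q, hq⟩
  refine ⟨p.reverse.append q, fun z hz => ?_⟩
  rw [Walk.mem_support_append_iff, Walk.support_reverse, List.mem_reverse] at hz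
  exact hz.elim (key a p hp z) (key b q hq z)

lemma walkConnected_support {u v : V} (p : G.Walk u v) : WalkConnected G {z | z ∈ p.support} := by
  classical
  intro a ha b hb
  refine ⟨(p.takeUntil a ha).reverse.append (p.takeUntil b hb), fun z hz => ?_⟩
  rw [Walk.mem_support_append_iff, Walk.support_reverse, List.mem_reverse] at hz
  exact hz.elim (fun h => p.support_takeUntil_subset_support ha h)
    (fun h => p.support_takeUntil_subset_support hb h)

/-- Among the walks inside `C` whose end points are related by `R`, some shortest one is a path. -/
lemma exists_shortest_path (R : V → V → Prop) (C : Set V) {a b : V} (hab : R a b)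
    (p : G.Walk a b) (hp : ∀ z ∈ p.support, z ∈ C) :
    ∃ (u y : V) (q : G.Walk u y), R u y ∧ (∀ z ∈ q.support, z ∈ C) ∧ q.IsPath ∧
      ∀ (u' y' : V) (q' : G.Walk u' y'), R u' y' → (∀ z ∈ q'.support, z ∈ C) →
        q.length ≤ q'.length := by
  classical
  have hex : ∃ n, ∃ (u y : V) (q : G.Walk u y), R u y ∧ (∀ z ∈ q.support, z ∈ C) ∧
      q.length = n := ⟨_, a, b, p, hab, hp, rfl⟩
  obtain ⟨u, y, q, hR, hq, hn⟩ := Nat.find_spec hex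
  refine ⟨u, y, q.bypass, hR, fun z hz => hq z (q.support_bypass_subset_support hz),
    q.bypass_isPath, fun u' y' q' hR' hq' => ?_⟩
  exact (q.length_bypass_le_length.trans hn.le).trans
    (Nat.find_min' hex ⟨u', y', q', hR', hq', rfl⟩)

/-- A chord of a walk shortens it. -/
lemma exists_shorter_walk_of_chord {u y a b : V} (q : G.Walk u y) (ha : a ∈ q.support)
    (hb : b ∈ q.support) (hab : G.Adj a b) (he : s(a, b) ∉ q.edges) :
    ∃ q' : G.Walk u y, q'.support ⊆ q.support ∧ q'.length < q.length := by
  classical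
  have key : ∀ (a b : V) (p₁ : G.Walk u a) (p₂ : G.Walk a b) (p₃ : G.Walk b y), G.Adj a b →
      q = p₁.append (p₂.append p₃) → s(a, b) ∉ q.edges →
      ∃ q' : G.Walk u y, q'.support ⊆ q.support ∧ q'.length < q.length := by
    rintro a b p₁ p₂ p₃ hab rfl he
    have hlen : 2 ≤ p₂.length := by
      by_contra! hlt
      cases p₂ with
      | nil => exact hab.ne rfl
      | cons h p =>
        cases p with
        | nil => simp at he
        | cons h' p => simp at hlt
    refine ⟨p₁.append (Walk.cons hab p₃), fun z hz => ?_, ?_⟩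
    · simp only [Walk.mem_support_append_iff, Walk.support_cons, List.mem_cons] at hz ⊢
      rcases hz with h | rfl | h
      · exact Or.inl h
      · exact Or.inl p₁.end_mem_support
      · exact Or.inr (Or.inr h)
    · simp only [Walk.length_append, Walk.length_cons]
      omega
  have hb' := hb
  rw [← q.take_spec ha, Walk.mem_support_append_iff] at hb'
  rcases hb' with hb' | hb'
  · refine key b a ((q.takeUntil a ha).takeUntil b hb') ((q.takeUntil a ha).dropUntil b hb')
      (q.dropUntil a ha) hab.symm ?_ (by rwa [Sym2.eq_swap])
    rw [Walk.append_assoc, Walk.take_spec, Walk.take_spec]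
  · refine key a b (q.takeUntil a ha) ((q.dropUntil a ha).takeUntil b hb')
      ((q.dropUntil a ha).dropUntil b hb') hab ?_ he
    rw [Walk.take_spec, Walk.take_spec]

end Walks

/-! ### Enlarging clique neighbourhoods in chordal graphs -/

section Chordal

variable {V : Type*} {H : SimpleGraph V}

/-- In a chordal graph, two adjacent vertices with neighbours in a connected set avoiding them have
a common neighbour in that set. -/
lemma IsChordal.exists_common_neighbor (hH : IsChordal H) {C : Set V} (hC : WalkConnected H C)
    {x x' : V} (hx : x ∉ C) (hx' : x' ∉ C) (hxx' : H.Adj x x') (h : ∃ a ∈ C, H.Adj a x)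
    (h' : ∃ a ∈ C, H.Adj a x') : ∃ v ∈ C, H.Adj v x ∧ H.Adj v x' := by
  classical
  by_contra! hno
  obtain ⟨b, hbC, hb⟩ := h
  obtain ⟨a, haC, ha⟩ := h'
  obtain ⟨p, hp⟩ := hC a haC b hbC
  obtain ⟨u, y, q, ⟨hu, hy⟩, hqC, hqp, hmin⟩ :=
    exists_shortest_path (fun u y => H.Adj u x' ∧ H.Adj y x) C ⟨ha, hb⟩ p hp
  have huC := hqC u q.start_mem_support
  have hyC := hqC y q.end_mem_support
  have huy : u ≠ y := by
    rintro rfl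
    exact hno u huC hy hu
  have hxq : x ∉ q.support := fun hz => hx (hqC x hz)
  have hx'q : x' ∉ q.support := fun hz => hx' (hqC x' hz)
  have hlastx : ∀ z ∈ q.support, H.Adj z x → z = y := by
    intro z hz hzx
    by_contra hne
    exact (hmin _ _ (q.takeUntil z hz) ⟨hu, hzx⟩ fun w hw =>
      hqC w (q.support_takeUntil_subset_support hz hw)).not_gt
        (Walk.length_takeUntil_lt_length hz hne)
  have hfirstx' : ∀ z ∈ q.support, H.Adj z x' → z = u := by
    intro z hz hzx
    by_contra hne
    have hle := hmin _ _ (q.dropUntil z hz) ⟨hzx, hy⟩ fun w hw =>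
      hqC w (q.support_dropUntil_subset_support hz hw)
    have hsum := congrArg Walk.length (q.take_spec hz)
    rw [Walk.length_append] at hsum
    exact hne (Walk.eq_of_length_eq_zero (p := q.takeUntil z hz) (by omega)).symm
  have hpath : (q.concat hy).IsPath := (Walk.concat_isPath_iff hy).2 ⟨hqp, hxq⟩
  -- By minimality only `y` on `q` is adjacent to `x` and only `u` to `x'`, while a chord within `q`
  -- would shorten it; so this cycle has no chord.
  have hcyc : (Walk.cons hxx' (Walk.cons hu.symm (q.concat hy))).IsCycle := by
    rw [Walk.cons_isCycle_iff, Walk.cons_isPath_iff]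
    refine ⟨⟨hpath, ?_⟩, ?_⟩
    · simp [Walk.support_concat, hx'q, hxx'.ne']
    · simp only [Walk.edges_cons, Walk.edges_concat, List.concat_eq_append, List.mem_cons,
        List.mem_append, List.not_mem_nil, or_false, not_or]
      refine ⟨?_, fun h => hxq (q.fst_mem_support_of_mem_edges h), ?_⟩
      · rw [Sym2.eq_iff]
        rintro (⟨h, -⟩ | ⟨h, -⟩)
        · exact hxx'.ne h
        · exact hx (h ▸ huC)
      · rw [Sym2.eq_iff]
        rintro (⟨h, -⟩ | ⟨-, h⟩)
        · exact hx (h ▸ hyC)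
        · exact hx' (h ▸ hyC)
  have hqlen : q.length ≠ 0 := fun h => huy (Walk.eq_of_length_eq_zero h)
  obtain ⟨s, hs, t, ht, hst, he⟩ := hH x _ hcyc (by
    simp only [Walk.length_cons, Walk.length_concat]; omega)
  simp only [Walk.support_cons, Walk.support_concat, List.mem_cons,
    List.mem_append, List.not_mem_nil, or_false] at hs ht
  simp only [Walk.edges_cons, Walk.edges_concat, List.concat_eq_append, List.mem_cons,
    List.mem_append, List.not_mem_nil, or_false, not_or] at he
  obtain ⟨he₁, he₂, he₃, he₄⟩ := he
  have hs' : s = x ∨ s = x' ∨ s ∈ q.support := by tauto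
  have ht' : t = x ∨ t = x' ∨ t ∈ q.support := by tauto
  rcases hs' with rfl | rfl | hs' <;> rcases ht' with rfl | rfl | ht'
  · exact hst.ne rfl
  · exact he₁ rfl
  · exact he₄ (by rw [hlastx t ht' hst.symm, Sym2.eq_swap])
  · exact he₁ Sym2.eq_swap
  · exact hst.ne rfl
  · exact he₂ (by rw [hfirstx' t ht' hst.symm])
  · exact he₄ (by rw [hlastx s hs' hst])
  · exact he₂ (by rw [hfirstx' s hs' hst, Sym2.eq_swap])
  · obtain ⟨q', hsub, hlt⟩ := exists_shorter_walk_of_chord q hs' ht' hst he₃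
    exact (hmin _ _ q' ⟨hu, hy⟩ fun z hz => hqC z (hsub hz)).not_gt hlt

lemma mem_outerNbhd {G : SimpleGraph V} {C : Set V} {x : V} :
    x ∈ outerNbhd G C ↔ (∃ a ∈ C, G.Adj a x) ∧ x ∉ C := by
  simp [outerNbhd]

/-- A neighbour of the component that lay in `B` would extend the walk and so belong to the
component. -/
lemma outerNbhd_reachable_within (G : SimpleGraph V) (B : Set V) (u : V) :
    outerNbhd G {x | ∃ p : G.Walk u x, ∀ z ∈ p.support, z ∈ B} ⊆ outerNbhd G B := by
  intro x hx
  obtain ⟨⟨a, ⟨p, hp⟩, hax⟩, hx⟩ := mem_outerNbhd.1 hx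
  refine mem_outerNbhd.2 ⟨⟨a, hp a p.end_mem_support, hax⟩, fun hxB => hx ⟨p.concat hax, ?_⟩⟩
  intro z hz
  rw [Walk.support_concat, List.mem_append, List.mem_singleton] at hz
  exact hz.elim (hp z) (fun h => h ▸ hxB)

/-- In a chordal graph, a connected set whose outer neighbourhood is a clique contains a vertex
adjacent to the whole outer neighbourhood. -/
lemma IsChordal.exists_isClique_insert [Finite V] (hH : IsChordal H) {C : Set V}
    (hC : WalkConnected H C) (hne : C.Nonempty) (hX : H.IsClique (outerNbhd H C)) :
    ∃ v ∈ C, H.IsClique (insert v (outerNbhd H C)) := by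
  classical
  obtain ⟨v, hvC, hv⟩ := (Set.toFinite C).exists_maximalFor
    (fun v => (H.neighborSet v ∩ outerNbhd H C).ncard) C hne
  refine ⟨v, hvC, hX.insert fun x hx _ => ?_⟩
  by_contra hvx
  obtain ⟨⟨b, hbC, hbx⟩, hxC⟩ := mem_outerNbhd.1 hx
  obtain ⟨p, hp⟩ := hC v hvC b hbC
  obtain ⟨u, y, q, ⟨rfl, hyx⟩, hqC, -, hmin⟩ :=
    exists_shortest_path (fun u y => u = v ∧ H.Adj y x) C ⟨rfl, hbx⟩ p hp
  have hlast : ∀ z ∈ q.support, H.Adj z x → z = y := by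
    intro z hz hzx
    by_contra hne
    exact (hmin _ _ (q.takeUntil z hz) ⟨rfl, hzx⟩ fun w hw =>
      hqC w (q.support_takeUntil_subset_support hz hw)).not_gt
        (Walk.length_takeUntil_lt_length hz hne)
  -- For `x'` in `N(C)` adjacent to `u`, the common neighbour of `x` and `x'` on `q` must be `y`,
  -- the only vertex of `q` adjacent to `x`. Thus `y` keeps all these neighbours and gains `x`,
  -- against the choice of `u`.
  have hsub : H.neighborSet u ∩ outerNbhd H C ⊂ H.neighborSet y ∩ outerNbhd H C := by
    refine (Set.ssubset_iff_of_subset ?_).2 ⟨x, ⟨hyx, hx⟩, fun h => hvx h.1⟩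
    rintro x' ⟨hux', hx'⟩
    refine ⟨?_, hx'⟩
    have hxx' : x ≠ x' := by
      rintro rfl
      exact hvx hux'
    obtain ⟨z, hz, hzx, hzx'⟩ := hH.exists_common_neighbor (walkConnected_support q)
      (fun h => hxC (hqC x h)) (fun h => (mem_outerNbhd.1 hx').2 (hqC x' h)) (hX hx hx' hxx')
      ⟨y, q.end_mem_support, hyx⟩ ⟨u, q.start_mem_support, hux'⟩
    rw [hlast z hz hzx] at hzx'
    exact hzx'
  have hlt := Set.ncard_lt_ncard hsub (Set.toFinite _)
  exact hlt.not_ge (hv (hqC y q.end_mem_support) hlt.le)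

end Chordal

/-! ### Gates in trees and bags -/

section TreeDecomposition

/-- The gate of a vertex `t` of a tree in a connected set `S`: every connected set that contains
`t` and meets `S` contains the gate. -/
lemma exists_gate {ι : Type*} {T : SimpleGraph ι} (hT : T.IsTree) {S : Set ι}
    (hS : WalkConnected T S) (hne : S.Nonempty) (t : ι) :
    ∃ g ∈ S, ∀ A : Set ι, WalkConnected T A → t ∈ A → (A ∩ S).Nonempty → g ∈ A := by
  classical
  obtain ⟨s, hs⟩ := hne
  obtain ⟨w⟩ := hT.connected.preconnected t s
  obtain ⟨u, g, p, ⟨rfl, hg⟩, -, hpp, hmin⟩ :=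
    exists_shortest_path (fun u y => u = t ∧ y ∈ S) Set.univ ⟨rfl, hs⟩ w (fun _ _ => trivial)
  refine ⟨g, hg, ?_⟩
  rintro A hA htA ⟨a, haA, haS⟩
  have hlast : ∀ z ∈ p.support, z ∈ S → z = g := by
    intro z hz hzS
    by_contra hne
    exact (hmin _ _ (p.takeUntil z hz) ⟨rfl, hzS⟩ fun _ _ => trivial).not_gt
        (Walk.length_takeUntil_lt_length hz hne)
  obtain ⟨q, hq⟩ := hS g hg a haS
  obtain ⟨r, hr⟩ := hA u htA a haA
  have hqp := q.bypass_isPath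
  -- `p` meets `S` only at `g`, and the rest stays in `S`. By uniqueness of tree paths, the path
  -- inside `A` from `u` to `a` is this one.
  have hpath : (p.append q.bypass).IsPath := by
    rw [Walk.isPath_def, Walk.support_append, List.nodup_append']
    refine ⟨hpp.support_nodup, hqp.support_nodup.tail, fun z hz hz' => ?_⟩
    have hzg := hlast z hz
      (hq z (q.support_bypass_subset_support (List.mem_of_mem_tail hz')))
    have hnd := hqp.support_nodup
    rw [← Walk.cons_tail_support, List.nodup_cons] at hnd
    exact hnd.1 (hzg ▸ hz')
  have heq := congrArg Subtype.val
    ((hT.isAcyclic.subsingleton_path u a).elim ⟨_, hpath⟩ ⟨r.bypass, r.bypass_isPath⟩)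
  have hgr : g ∈ r.bypass.support := by
    rw [← show p.append q.bypass = r.bypass from heq, Walk.mem_support_append_iff]
    exact Or.inl p.end_mem_support
  exact hr g (r.support_bypass_subset_support hgr)

variable {V : Type u} {G : SimpleGraph V} {ι : Type} {T : SimpleGraph ι} {bag : ι → Finset V}

/-- The tree vertices whose bags meet a connected set are connected. -/
lemma IsTreeDecomposition.walkConnected_bags (h : IsTreeDecomposition G T bag) {C : Set V}
    (hC : WalkConnected G C) : WalkConnected T {t | ∃ v ∈ C, v ∈ bag t} := by
  have key : ∀ (a b : V) (p : G.Walk a b), (∀ z ∈ p.support, z ∈ C) → ∀ s s', a ∈ bag s →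
      b ∈ bag s' → ∃ w : T.Walk s s', ∀ z ∈ w.support, ∃ v ∈ C, v ∈ bag z := by
    intro a b p
    induction p with
    | nil =>
      intro hp s s' hs hs'
      obtain ⟨w, hw⟩ := walkConnected_of_induce_preconnected (h.connected _) s hs s' hs'
      exact ⟨w, fun z hz => ⟨_, hp _ (by simp), hw z hz⟩⟩
    | cons hadj p ih =>
      intro hp s s' hs hs'
      obtain ⟨r, hr, hr'⟩ := h.edge_mem _ _ hadj
      obtain ⟨w, hw⟩ := walkConnected_of_induce_preconnected (h.connected _) s hs r hr
      obtain ⟨w', hw'⟩ := ih (fun z hz => hp z (by simp [hz])) r s' hr' hs'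
      refine ⟨w.append w', fun z hz => ?_⟩
      rw [Walk.mem_support_append_iff] at hz
      exact hz.elim (fun hz => ⟨_, hp _ (by simp), hw z hz⟩) (hw' z)
  rintro s ⟨a, haC, ha⟩ s' ⟨b, hbC, hb⟩
  obtain ⟨p, hp⟩ := hC a haC b hbC
  exact key a b p hp s s' ha hb

/-- If the outer neighbourhood of a connected set lies in a bag, then it lies in a bag that meets
the connected set. -/
lemma IsTreeDecomposition.exists_insert_subset_bag (h : IsTreeDecomposition G T bag) {C : Set V}
    (hC : WalkConnected G C) (hne : C.Nonempty) (hX : ∃ t, outerNbhd G C ⊆ (bag t : Set V)) :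
    ∃ v ∈ C, ∃ t, insert v (outerNbhd G C) ⊆ (bag t : Set V) := by
  obtain ⟨t, ht⟩ := hX
  obtain ⟨a, haC⟩ := hne
  obtain ⟨s, hs⟩ := h.vertex_mem a
  obtain ⟨g, ⟨v, hvC, hv⟩, hg⟩ :=
    exists_gate h.isTree (h.walkConnected_bags hC) ⟨s, a, haC, hs⟩ t
  refine ⟨v, hvC, g, Set.insert_subset hv fun x hx => ?_⟩
  obtain ⟨⟨b, hbC, hbx⟩, -⟩ := mem_outerNbhd.1 hx
  obtain ⟨r, hrb, hrx⟩ := h.edge_mem _ _ hbx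
  -- The subtree of `x` contains `t` and meets the bags of `C`, so it contains the gate.
  exact hg {t | x ∈ bag t} (walkConnected_of_induce_preconnected (h.connected x)) (ht hx)
    ⟨r, hrx, b, hbC, hrb⟩

end TreeDecomposition

/-! ### Linear-size members in expanders, and the three bounds -/

section Expander

variable {V : Type u} [Fintype V] {G H : SimpleGraph V} {c : ℝ}

lemma IsExpander.le_ncard (h : IsExpander G c) {S : Set V} (hS : 2 * S.ncard ≤ Fintype.card V) :
    c * (S.ncard : ℝ) ≤ ((outerNbhd G S).ncard : ℝ) := by
  classical
  have hS' : (2 * S.ncard : ℝ) ≤ Fintype.card V := by exact_mod_cast hS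
  have := h S.toFinset (by rw [← Set.ncard_eq_toFinset_card']; linarith)
  rwa [← Set.ncard_eq_toFinset_card', Set.coe_toFinset] at this

lemma IsExpander.mono (h : IsExpander G c) (hGH : G ≤ H) : IsExpander H c := by
  intro S hS
  refine (h S hS).trans (Nat.cast_le.2 (Set.ncard_le_ncard (fun x hx => ?_) (Set.toFinite _)))
  obtain ⟨⟨a, ha, hax⟩, hx⟩ := mem_outerNbhd.1 hx
  exact mem_outerNbhd.2 ⟨⟨a, ha, hGH hax⟩, hx⟩

lemma IsExpander.exists_adj (h : IsExpander G c) (hc : 0 < c) (hn : 2 ≤ Fintype.card V) (v : V) :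
    ∃ w, G.Adj v w := by
  have h₁ := h.le_ncard (S := {v}) (by simpa using hn)
  rw [Set.ncard_singleton, Nat.cast_one, mul_one] at h₁
  have h₂ : (outerNbhd G {v}).ncard ≠ 0 := by
    intro h0
    rw [h0, Nat.cast_zero] at h₁
    linarith
  obtain ⟨w, hw⟩ := Set.nonempty_of_ncard_ne_zero h₂
  obtain ⟨⟨a, rfl, ha⟩, -⟩ := mem_outerNbhd.1 hw
  exact ⟨w, ha⟩

/-- A component has empty outer neighbourhood, so it exceeds half of the vertices; two disjoint ones
do not fit. -/
lemma IsExpander.walkConnected_univ (h : IsExpander G c) (hc : 0 < c) :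
    WalkConnected G Set.univ := by
  intro a _ b _
  by_contra! hno
  have key : ∀ u : V, Fintype.card V <
      2 * {x | ∃ p : G.Walk u x, ∀ z ∈ p.support, z ∈ (Set.univ : Set V)}.ncard := by
    intro u
    by_contra! hle
    have h₁ := h.le_ncard hle
    have h₂ := outerNbhd_reachable_within G Set.univ u
    have h₃ : outerNbhd G (Set.univ : Set V) = ∅ := by simp [outerNbhd]
    rw [h₃, Set.subset_empty_iff] at h₂
    rw [h₂, Set.ncard_empty, Nat.cast_zero] at h₁
    have h₄ : 0 < {x | ∃ p : G.Walk u x, ∀ z ∈ p.support, z ∈ (Set.univ : Set V)}.ncard :=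
      (Set.ncard_pos (Set.toFinite _)).2 ⟨u, Walk.nil, fun _ _ => trivial⟩
    have h₅ : (0 : ℝ) < {x | ∃ p : G.Walk u x, ∀ z ∈ p.support, z ∈ (Set.univ : Set V)}.ncard := by
      exact_mod_cast h₄
    nlinarith
  have hdisj : Disjoint {x | ∃ p : G.Walk a x, ∀ z ∈ p.support, z ∈ (Set.univ : Set V)}
      {x | ∃ p : G.Walk b x, ∀ z ∈ p.support, z ∈ (Set.univ : Set V)} := by
    rw [Set.disjoint_left]
    rintro x ⟨p, -⟩ ⟨q, -⟩
    obtain ⟨z, -, hz⟩ := hno (p.append q.reverse)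
    exact hz trivial
  have hu := Set.ncard_union_eq hdisj (Set.toFinite _) (Set.toFinite _)
  have hle := Set.ncard_le_card
    ({x | ∃ p : G.Walk a x, ∀ z ∈ p.support, z ∈ (Set.univ : Set V)} ∪
      {x | ∃ p : G.Walk b x, ∀ z ∈ p.support, z ∈ (Set.univ : Set V)})
  rw [Nat.card_eq_fintype_card] at hle
  have ha := key a
  have hb := key b
  omega

/-- Let `P` be a family of vertex sets, closed under subsets, such that the outer neighbourhood of
a connected set `C`, if it belongs to `P`, can be enlarged within `P` by a vertex of `C`. In an
expander such a family has a member of linear size. -/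
theorem IsExpander.exists_large (h : IsExpander H c) (hc : 0 < c) (hn : 2 ≤ Fintype.card V)
    (P : Set V → Prop) (hmono : ∀ X Y, Y ⊆ X → P X → P Y) (hempty : P ∅)
    (hstep : ∀ C : Set V, WalkConnected H C → C.Nonempty → P (outerNbhd H C) →
      ∃ v ∈ C, P (insert v (outerNbhd H C))) :
    ∃ X, P X ∧ c / 4 * (Fintype.card V : ℝ) ≤ (X.ncard : ℝ) := by
  classical
  set n := Fintype.card V
  have hinit : {C : Set V | WalkConnected H C ∧ P (outerNbhd H C) ∧
      n < 2 * C.ncard}.Nonempty := by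
    refine ⟨Set.univ, h.walkConnected_univ hc, by simpa [outerNbhd] using hempty, ?_⟩
    rw [Set.ncard_univ, Nat.card_eq_fintype_card]
    omega
  obtain ⟨C, ⟨hC, hPC, hnC⟩, hmin⟩ := (Set.toFinite _).exists_minimalFor Set.ncard _ hinit
  obtain ⟨v, hvC, hPv⟩ := hstep C hC (Set.nonempty_of_ncard_ne_zero (by omega)) hPC
  set X := insert v (outerNbhd H C)
  refine ⟨X, hPv, ?_⟩
  have hB : outerNbhd H (C \ {v}) ⊆ X := by
    intro x hx
    obtain ⟨⟨a, ha, hax⟩, hx⟩ := mem_outerNbhd.1 hx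
    by_cases hxv : x = v
    · exact Or.inl hxv
    · exact Or.inr (mem_outerNbhd.2 ⟨⟨a, ha.1, hax⟩, fun hxC => hx ⟨hxC, hxv⟩⟩)
  have hsmall : ∀ A : Set V, outerNbhd H A ⊆ X → 2 * A.ncard ≤ n →
      c * (A.ncard : ℝ) ≤ (X.ncard : ℝ) := fun A hA hAn =>
    (h.le_ncard hAn).trans (Nat.cast_le.2 (Set.ncard_le_ncard hA (Set.toFinite _)))
  have hlarge : ∀ A : Set V, outerNbhd H A ⊆ X → 2 * A.ncard ≤ n → n ≤ 4 * A.ncard →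
      c / 4 * (n : ℝ) ≤ (X.ncard : ℝ) := by
    intro A hA hAn hnA
    have h₁ := hsmall A hA hAn
    have h₂ : (n : ℝ) ≤ 4 * A.ncard := by exact_mod_cast hnA
    nlinarith
  obtain ⟨A, ⟨hAC, hAX, hAn⟩, hmax⟩ := (Set.toFinite
    {A : Set V | A ⊆ C \ {v} ∧ outerNbhd H A ⊆ X ∧ 2 * A.ncard ≤ n}).exists_maximalFor
      Set.ncard _ ⟨∅, by simp, by simp [outerNbhd], by simp⟩
  by_cases hAeq : A = C \ {v}
  · refine hlarge A hAX hAn ?_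
    -- Here `4|A| = 4|C| - 4 ≥ 2n - 2 ≥ n`, since `n ≥ 2`.
    have := Set.ncard_sdiff_singleton_add_one hvC (Set.toFinite _)
    rw [← hAeq] at this
    omega
  obtain ⟨u, hu, huA⟩ := Set.exists_of_ssubset (hAC.ssubset_of_ne hAeq)
  set D := {x | ∃ p : H.Walk u x, ∀ z ∈ p.support, z ∈ C \ {v}}
  have hDC : D ⊆ C \ {v} := fun x ⟨p, hp⟩ => hp x p.end_mem_support
  have huD : u ∈ D := ⟨Walk.nil, by simpa using hu⟩
  have hDX : outerNbhd H D ⊆ X := (outerNbhd_reachable_within H _ u).trans hB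
  have hDn : 2 * D.ncard ≤ n := by
    by_contra! hlt
    have hlt' : D.ncard < C.ncard := Set.ncard_lt_ncard
      ((Set.ssubset_iff_of_subset fun x hx => (hDC hx).1).2
        ⟨v, hvC, fun hv => (hDC hv).2 rfl⟩) (Set.toFinite _)
    exact hlt'.not_ge
      (hmin ⟨walkConnected_reachable_within _ u, hmono _ _ hDX hPv, hlt⟩ hlt'.le)
  have hADX : outerNbhd H (A ∪ D) ⊆ X := by
    intro x hx
    obtain ⟨⟨a, ha | ha, hax⟩, hx⟩ := mem_outerNbhd.1 hx
    · exact hAX (mem_outerNbhd.2 ⟨⟨a, ha, hax⟩, fun hxA => hx (Or.inl hxA)⟩)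
    · exact hDX (mem_outerNbhd.2 ⟨⟨a, ha, hax⟩, fun hxD => hx (Or.inr hxD)⟩)
  have hADn : n < 2 * (A ∪ D).ncard := by
    by_contra! hle
    have hlt : A.ncard < (A ∪ D).ncard := Set.ncard_lt_ncard
      ((Set.ssubset_iff_of_subset Set.subset_union_left).2 ⟨u, Or.inr huD, huA⟩) (Set.toFinite _)
    exact hlt.not_ge (hmax ⟨Set.union_subset hAC hDC, hADX, hle⟩ hlt.le)
  -- `|A| + |D| > n/2`, so the larger of the two exceeds `n/4`.
  have hun := Set.ncard_union_le A D
  rcases le_total A.ncard D.ncard with hAD | hAD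
  · exact hlarge D hDX hDn (by omega)
  · exact hlarge A hAX hAn (by omega)

theorem IsExpander.le_treewidth (h : IsExpander G c) (hc : 0 < c) (hn : 2 ≤ Fintype.card V) :
    c / 8 * (Fintype.card V : ℝ) ≤ (treewidth G : ℝ) := by
  classical
  obtain ⟨m, T, bag, hTD, hw⟩ := Nat.sInf_mem (exists_hasTreeDecompositionOfWidth G)
  change ∀ t, (bag t).card ≤ treewidth G + 1 at hw
  obtain ⟨v⟩ : Nonempty V := Fintype.card_pos_iff.1 (by omega)
  obtain ⟨w, hvw⟩ := h.exists_adj hc hn v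
  obtain ⟨t₀, hv, hw₀⟩ := hTD.edge_mem v w hvw
  have hone : 1 < (bag t₀).card := Finset.one_lt_card.2 ⟨v, hv, w, hw₀, hvw.ne⟩
  obtain ⟨X, ⟨t, ht⟩, hX⟩ := h.exists_large hc hn (fun X => ∃ t, X ⊆ (bag t : Set V))
    (fun X Y hYX ⟨t, ht⟩ => ⟨t, hYX.trans ht⟩) ⟨t₀, Set.empty_subset _⟩
    (fun C hC hne hPC => hTD.exists_insert_subset_bag hC hne hPC)
  have hXt := Set.ncard_le_ncard ht (Set.toFinite _)
  rw [Set.ncard_coe_finset] at hXt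
  -- The bag `t₀` holds an edge, so the treewidth is at least 1 and `tw + 1 ≤ 2 tw`; this halves `c
  -- / 4`.
  have h₁ := hw t
  have h₀ := hw t₀
  have h₂ : X.ncard ≤ 2 * treewidth G := by omega
  have h₃ : (X.ncard : ℝ) ≤ 2 * treewidth G := by exact_mod_cast h₂
  linarith

theorem IsExpander.exists_large_clique (h : IsExpander H c) (hc : 0 < c)
    (hn : 2 ≤ Fintype.card V) (hH : IsChordal H) :
    ∃ s : Finset V, H.IsClique (s : Set V) ∧ c / 4 * (Fintype.card V : ℝ) ≤ (s.card : ℝ) := by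
  classical
  obtain ⟨X, hX, hle⟩ := h.exists_large hc hn (fun X => H.IsClique X)
    (fun X Y hYX hX => hX.subset hYX) (by simp)
    (fun C hC hne hPC => hH.exists_isClique_insert hC hne hPC)
  refine ⟨X.toFinset, by simpa using hX, ?_⟩
  rwa [← Set.ncard_eq_toFinset_card']

lemma choose_two_le_ncard_edgeSet {s : Finset V} (hs : H.IsClique (s : Set V)) :
    s.card.choose 2 ≤ H.edgeSet.ncard := by
  classical
  rw [← Sym2.card_image_offDiag, ← Set.ncard_coe_finset]
  refine Set.ncard_le_ncard (fun e he => ?_) (Set.toFinite _)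
  rw [Finset.mem_coe, Finset.mem_image] at he
  obtain ⟨⟨a, b⟩, hab, rfl⟩ := he
  rw [Finset.mem_offDiag] at hab
  exact hs hab.1 hab.2.1 hab.2.2

theorem IsExpander.le_ncard_edgeSet (h : IsExpander H c) (hc : 0 < c)
    (hn : 2 ≤ Fintype.card V) (hH : IsChordal H) :
    c ^ 2 / 64 * (Fintype.card V : ℝ) ^ 2 ≤ (H.edgeSet.ncard : ℝ) := by
  obtain ⟨s, hs, hle⟩ := h.exists_large_clique hc hn hH
  have hpos : 0 ≤ c / 4 * (Fintype.card V : ℝ) := by positivity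
  have hsq : (c / 4 * (Fintype.card V : ℝ)) ^ 2 ≤ (s.card : ℝ) ^ 2 := by gcongr
  -- For `k = |s| ≥ 2`, `k(k-1)/2 ≥ k²/4`; for `k ≤ 1`, a single edge of `H` suffices.
  suffices hcard : (s.card : ℝ) ^ 2 ≤ 4 * H.edgeSet.ncard by nlinarith
  rcases le_or_gt 2 s.card with h2 | h2
  · have h₁ : ((s.card.choose 2 : ℕ) : ℝ) ≤ H.edgeSet.ncard :=
      Nat.cast_le.2 (choose_two_le_ncard_edgeSet hs)
    rw [Nat.cast_choose_two] at h₁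
    have h₂ : (2 : ℝ) ≤ s.card := by exact_mod_cast h2
    nlinarith
  · obtain ⟨v⟩ : Nonempty V := Fintype.card_pos_iff.1 (by omega)
    obtain ⟨w, hvw⟩ := h.exists_adj hc hn v
    have h₁ : 0 < H.edgeSet.ncard := (Set.ncard_pos (Set.toFinite _)).2 ⟨s(v, w), hvw⟩
    have h₂ : (1 : ℝ) ≤ H.edgeSet.ncard := by exact_mod_cast h₁
    have h₃ : (s.card : ℝ) ≤ 1 := by exact_mod_cast Nat.lt_succ_iff.1 h2
    have h₄ : (0 : ℝ) ≤ s.card := Nat.cast_nonneg _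
    nlinarith

end Expander

end ChordalLB

theorem mainTheorem7 (c : ℝ) (hc : 0 < c) :
    ∃ K : ℝ, 0 < K ∧
      ∀ (V : Type u) [Fintype V] (G : SimpleGraph V),
        2 ≤ Fintype.card V → ChordalLB.IsExpander G c →
          K * (Fintype.card V : ℝ) ≤ (ChordalLB.treewidth G : ℝ) ∧
          ∀ H : SimpleGraph V, ChordalLB.IsChordalCompletion G H →
            (∃ s : Finset V, H.IsClique (s : Set V) ∧ K * (Fintype.card V : ℝ) ≤ (s.card : ℝ)) ∧
            K * (Fintype.card V : ℝ) ^ 2 ≤ (H.edgeSet.ncard : ℝ) := by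
  refine ⟨min (c / 8) (c ^ 2 / 64), by positivity, fun V _ G hn hG => ⟨?_, fun H hH => ?_⟩⟩
  · refine le_trans ?_ (hG.le_treewidth hc hn)
    gcongr
    exact min_le_left _ _
  · have hHc := hG.mono hH.1
    refine ⟨?_, ?_⟩
    · obtain ⟨s, hs, hle⟩ := hHc.exists_large_clique hc hn hH.2
      refine ⟨s, hs, le_trans ?_ hle⟩
      gcongr
      exact (min_le_left _ _).trans (by linarith)
    · refine le_trans ?_ (hHc.le_ncard_edgeSet hc hn hH.2)
      gcongr
      exact min_le_right _ _
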